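/- Consider one user whose channel is a Markov chain on $\{1,\dots,K\}$, $K\ge 1$, with transition matrix $P$; write $p_{ji}^{(\tau)}=(P^\tau)_{ji}$. The belief states are $\vec\pi_j^\tau=\vec e_jP^\tau$, $1\le j\le K$, $\tau\ge 1$ (the channel was last observed $\tau$ slots ago, in state $j$); they are treated as labelled by $(j,\tau)$. In each slot the user is either passive, with reward $R(\vec\pi_j^\tau,0)+W$, and then the belief state moves from $\vec\pi_j^\tau$ to $\vec\pi_j^{\tau+1}$, or active, with reward $R^1$, and then the belief state moves to $\vec\pi_i^1$ with probability $p_{ji}^{(\tau)}$ in the original POMDP, and with probability $p_i^s$ (the steady-state probability of channel state $i$) in the approximation. Here $W\in\mathbb R$ is a fixed subsidy, and $R^1\ge R(\vec\pi_j^\tau,0)\ge R(\vec\pi_j^{\tau'},0)$ for all $j$ and all $\tau'\ge\tau\ge 1$. For $0\le\beta<1$ let $V_\beta(\pi)$ be the supremum over all policies of the expected total $\beta$-discounted reward in the original POMDP from the belief state $\pi$, and let $V_\beta^{\max}$ and $V_\beta^{\min}$ be the bounded solutions of $$V_\beta^{\max}(\vec\pi_j^\tau)=\max\{R(\vec\pi_j^\tau,0)+W+\beta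 V_\beta^{\max}(\vec\pi_j^{\tau+1});\ R^1+\beta\max_iV_\beta^{\max}(\vec\pi_i^1)\},$$ $$V_\beta^{\min}(\vec\pi_j^\tau)=\max\{R(\vec\pi_j^\tau,0)+W+\beta V_\beta^{\min}(\vec\pi_j^{\tau+1});\ R^1+\beta\min_iV_\beta^{\min}(\vec\pi_i^1)\}.$$ (i) For every $0\le\beta<1$ these bounded solutions exist and are unique, and $V_\beta^{\min}(\pi)\le V_\beta(\pi)\le V_\beta^{\max}(\pi)$ for every belief state $\pi$. (ii) Suppose that $P$ is irreducible, with stationary distribution $(p_1^s,\dots,p_K^s)$, and that $R^1>0$. Then the optimal long-run expected average rewards (the suprema over all policies of $\liminf_{T\to\infty}\frac1T\mathbb E\sum_{t=1}^T r_t$, where $r_t$ is the reward of slot $t$) of the original POMDP and of the approximation are real numbers $g(W)$ and $g^{app}(W)$ that do not depend on the initial belief state. The limits $g^{\max}(W)=\lim_{\beta\to1}(1-\beta)V_\beta^{\max}(\pi)$ and $g^{\min}(W,\pi)=\lim_{\beta\to1}(1-\beta)V_\beta^{\min}(\pi)$ exist for every belief state $\pi$, the former is independent of $\pi$, $0<g^{\min}(W,\pi)\le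 g(W)\le g^{\max}(W)$, and for every belief state $\pi$ $$\left|1-\frac{g^{app}(W)}{g(W)}\right|\le D(W):=\max\left\{1-\frac{g^{app}(W)}{g^{\max}(W)},\ \frac{g^{app}(W)}{g^{\min}(W,\pi)}-1\right\}.$$ -/

import Mathlib

open Filter Topology Matrix

noncomputable section

namespace PilotAllocation

/-- The belief states of one user: `(j, τ)` stands for the belief vector `e_j P ^ τ`, `τ ≥ 1`, that
is, the user was last sensed `τ` slots ago and its channel was then seen in state `j`. -/
abbrev BeliefState (K : ℕ) := Fin K × ℕ+

/-- The transition probabilities `q ^ a (s, s')` between belief states. The action `true` is the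
active one (allocate a pilot), `false` the passive one. Under the passive action the belief only
ages by one slot. Under the active action in state `s` the channel is observed, and it is found in
state `i` with probability `ρ s i`; the next belief state is then `(i, 1)`. -/
def trans {K : ℕ} (ρ : BeliefState K → Fin K → ℝ) :
    Bool → BeliefState K → BeliefState K → ℝ
  | false, s, s' => if s'.1 = s.1 ∧ s'.2 = s.2 + 1 then 1 else 0
  | true, s, s' => if s'.2 = 1 then ρ s s'.1 else 0

/-- Observation probabilities of the original POMDP: the channel is found in state `i` with the
probability `p_{ji}^{(τ)}`, the `(j, i)` entry of `P ^ τ`. -/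
def exactObs {K : ℕ} (P : Matrix (Fin K) (Fin K) ℝ) : BeliefState K → Fin K → ℝ :=
  fun s i => (P ^ (s.2 : ℕ)) s.1 i

/-- Observation probabilities of the approximation: the channel is found in state `i` with the
steady-state probability `p_i^s`, whatever the belief state. -/
def approxObs {K : ℕ} (ps : Fin K → ℝ) : BeliefState K → Fin K → ℝ :=
  fun _ i => ps i

/-- Average immediate reward, including the subsidy `W` for passivity: `R1` when active, and
`R0 j τ + W` when passive in the belief state `(j, τ)`. -/
def reward {K : ℕ} (R0 : Fin K → ℕ+ → ℝ) (R1 W : ℝ) : Bool → BeliefState K → ℝ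
  | false, s => R0 s.1 s.2 + W
  | true, _ => R1

/-- A policy: it picks the action from the list of the past belief states (the most recent one
first) and the current belief state. -/
abbrev Policy (K : ℕ) := List (BeliefState K) → BeliefState K → Bool

/-- The expected reward collected `t` slots after the present one under the policy `φ`, given
the past `h` and the present belief state `s`. -/
def expectedReward {K : ℕ} (ρ : BeliefState K → Fin K → ℝ) (R0 : Fin K → ℕ+ → ℝ) (R1 W : ℝ)
    (φ : Policy K) : ℕ → List (BeliefState K) → BeliefState K → ℝ
  | 0, h, s => reward R0 R1 W (φ h s) s
  | t + 1, h, s =>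
      ∑' s', trans ρ (φ h s) s s' * expectedReward ρ R0 R1 W φ t (s :: h) s'

/-- The value function `V_β` of the `β`-discounted single-arm problem: the supremum over all
policies of the (lower limit of the) total expected discounted reward from the initial state `s`. -/
def discountedValue {K : ℕ} (ρ : BeliefState K → Fin K → ℝ) (R0 : Fin K → ℕ+ → ℝ) (R1 W : ℝ)
    (β : ℝ) (s : BeliefState K) : EReal :=
  ⨆ φ : Policy K, liminf (fun T : ℕ =>
    ((∑ t ∈ Finset.range T, β ^ t * expectedReward ρ R0 R1 W φ t [] s : ℝ) : EReal)) atTop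

/-- The optimal long-run expected average reward from the initial state `s`. -/
def optimalAverage {K : ℕ} (ρ : BeliefState K → Fin K → ℝ) (R0 : Fin K → ℕ+ → ℝ) (R1 W : ℝ)
    (s : BeliefState K) : EReal :=
  ⨆ φ : Policy K, liminf (fun T : ℕ =>
    (((∑ t ∈ Finset.range T, expectedReward ρ R0 R1 W φ t [] s) / T : ℝ) : EReal)) atTop

/-- `V` is the value function `V_β^max`: the bounded solution of the Bellman equation in which
an active action is followed by the best of the states `(i, 1)`. -/
def IsMaxValue {K : ℕ} (R0 : Fin K → ℕ+ → ℝ) (R1 W β : ℝ) (V : BeliefState K → ℝ) : Prop :=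
  (∃ C, ∀ s, |V s| ≤ C) ∧
  ∀ j τ, V (j, τ) = max (R0 j τ + W + β * V (j, τ + 1)) (R1 + β * ⨆ i, V (i, 1))

/-- `V` is the value function `V_β^min`: the bounded solution of the Bellman equation in which
an active action is followed by the worst of the states `(i, 1)`. -/
def IsMinValue {K : ℕ} (R0 : Fin K → ℕ+ → ℝ) (R1 W β : ℝ) (V : BeliefState K → ℝ) : Prop :=
  (∃ C, ∀ s, |V s| ≤ C) ∧
  ∀ j τ, V (j, τ) = max (R0 j τ + W + β * V (j, τ + 1)) (R1 + β * ⨅ i, V (i, 1))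

/-- The expectation of `f` over the next belief state after a passive action. -/
theorem tsum_trans_false {K : ℕ} (ρ : BeliefState K → Fin K → ℝ) (s : BeliefState K)
    (f : BeliefState K → ℝ) : ∑' s', trans ρ false s s' * f s' = f (s.1, s.2 + 1) := by
  rw [tsum_eq_single (s.1, s.2 + 1)]
  · simp [trans]
  · rintro ⟨i, σ⟩ h
    have : ¬ (i = s.1 ∧ σ = s.2 + 1) := fun h' => h (Prod.ext h'.1 h'.2)
    simp [trans, this]

/-- The expectation of `f` over the next belief state after an active action. -/
theorem tsum_trans_true {K : ℕ} (ρ : BeliefState K → Fin K → ℝ) (s : BeliefState K)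
    (f : BeliefState K → ℝ) : ∑' s', trans ρ true s s' * f s' = ∑ i, ρ s i * f (i, 1) := by
  rw [tsum_eq_sum (s := Finset.univ.image fun i : Fin K => ((i, 1) : BeliefState K)),
    Finset.sum_image (fun a _ b _ h => (Prod.ext_iff.1 h).1)]
  · simp [trans]
  · rintro ⟨i, σ⟩ h
    have : σ ≠ 1 := by
      rintro rfl
      exact h (Finset.mem_image.2 ⟨i, Finset.mem_univ i, rfl⟩)
    simp [trans, this]

end PilotAllocation

end

noncomputable section

namespace PilotAllocation

/-! The original POMDP, the approximation, `V_β^max` and `V_β^min` obey Bellman equations that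
differ only in the continuation value `Φ` of the active action: an average, the maximum or the
minimum of the values of the states `(i, 1)`. Each `Φ` is monotone and commutes with adding
constants. Hence the Bellman operator is a `β`-contraction with a comparison principle, and min ≤
average ≤ max makes `V_β^max` a supersolution and `V_β^min` a subsolution of the true equation. A
supersolution bounds every policy from above; a subsolution is bounded above by the value of a
stationary policy. This gives the sandwich.

For the average reward the discount is made to vanish. If the oscillation of `V_β` is at most `C`
uniformly as `β → 1`, then `(1 - β) V_β` is Cauchy, and `V_β` satisfies the average-reward
optimality inequalities up to `(1 - β) C`, so the limit is the optimal average reward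
(`exists_optimalAverage_eq`). It suffices to bound the oscillation on the states `(i, 1)`, because
`R0 j` is antitone (`IsBellmanSolution.abs_sub_le`). There the bound is immediate for the maximum,
and follows from irreducibility for an average.

For `V_β^min` the limit may depend on the state, since passivity forever may be better from some `j`
than from others. The minimum over the states `(i, 1)` reduces to finitely many one-state problems
and has a limit `μ`; the limit at `(j, τ)` is then the larger of `μ` and `inf_σ R0 j σ + W`, or just
`μ` if `R0 j` is unbounded below. Permanent activity earns `R1 > 0`, whence positivity; the error
bound is monotonicity of `x / g` in `g`. -/

/-- A monotone, translation invariant and normalized continuation value `Φ s v` of the active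
action in the state `s`, where `v i` is the value of the state `(i, 1)`. -/
structure IsTopical {K : ℕ} (Φ : BeliefState K → (Fin K → ℝ) → ℝ) : Prop where
  le_add : ∀ s v w c, (∀ i, v i ≤ w i + c) → Φ s v ≤ Φ s w + c
  zero : ∀ s, Φ s 0 = 0

/-- The Bellman operator whose active action has the continuation value `Φ`. -/
def bellman {K : ℕ} (Φ : BeliefState K → (Fin K → ℝ) → ℝ) (R0 : Fin K → ℕ+ → ℝ) (R1 W β : ℝ)
    (V : BeliefState K → ℝ) (s : BeliefState K) : ℝ :=
  max (R0 s.1 s.2 + W + β * V (s.1, s.2 + 1)) (R1 + β * Φ s fun i => V (i, 1))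

/-- `V` is a bounded solution of the Bellman equation. -/
def IsBellmanSolution {K : ℕ} (Φ : BeliefState K → (Fin K → ℝ) → ℝ) (R0 : Fin K → ℕ+ → ℝ)
    (R1 W β : ℝ) (V : BeliefState K → ℝ) : Prop :=
  (∃ C, ∀ s, |V s| ≤ C) ∧ ∀ s, V s = bellman Φ R0 R1 W β V s

/-! ### Averages, maxima and minima as topical functions. -/

section Topical

variable {K : ℕ} {Φ : BeliefState K → (Fin K → ℝ) → ℝ}

theorem IsTopical.le_const (hΦ : IsTopical Φ) (s : BeliefState K) {v : Fin K → ℝ} {c : ℝ}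
    (h : ∀ i, v i ≤ c) : Φ s v ≤ c := by
  simpa [hΦ.zero] using hΦ.le_add s v 0 c (by simpa using h)

theorem IsTopical.const_le (hΦ : IsTopical Φ) (s : BeliefState K) {v : Fin K → ℝ} {c : ℝ}
    (h : ∀ i, c ≤ v i) : c ≤ Φ s v := by
  have := hΦ.le_add s 0 v (-c) (fun i => by simpa using h i)
  rw [hΦ.zero] at this
  linarith

theorem IsTopical.abs_apply_le (hΦ : IsTopical Φ) (s : BeliefState K) {v : Fin K → ℝ} {c : ℝ}
    (h : ∀ i, |v i| ≤ c) : |Φ s v| ≤ c :=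
  abs_le.2 ⟨hΦ.const_le s fun i => (abs_le.1 (h i)).1,
    hΦ.le_const s fun i => (abs_le.1 (h i)).2⟩

theorem isTopical_sum {ρ : BeliefState K → Fin K → ℝ} (h0 : ∀ s i, 0 ≤ ρ s i)
    (h1 : ∀ s, ∑ i, ρ s i = 1) : IsTopical fun s v => ∑ i, ρ s i * v i where
  le_add s v w c h := by
    calc ∑ i, ρ s i * v i ≤ ∑ i, ρ s i * (w i + c) :=
          Finset.sum_le_sum fun i _ => mul_le_mul_of_nonneg_left (h i) (h0 s i)
      _ = ∑ i, ρ s i * w i + c := by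
          simp only [mul_add, Finset.sum_add_distrib, ← Finset.sum_mul, h1, one_mul]
  zero s := by simp

theorem isTopical_iSup [NeZero K] :
    IsTopical fun (_ : BeliefState K) (v : Fin K → ℝ) => ⨆ i, v i where
  le_add s v w c h := ciSup_le fun i =>
    (h i).trans (add_le_add_left (le_ciSup (Set.finite_range w).bddAbove i) c)
  zero s := by simp

theorem isTopical_iInf [NeZero K] :
    IsTopical fun (_ : BeliefState K) (v : Fin K → ℝ) => ⨅ i, v i where
  le_add s v w c h := by
    have : (⨅ i, v i) - c ≤ ⨅ i, w i := le_ciInf fun i => by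
      have := ciInf_le (Set.finite_range v).bddBelow i
      linarith [h i]
    linarith
  zero s := by simp

end Topical

/-! ### The discounted Bellman equation: comparison, existence, uniqueness. -/

section Bellman

variable {K : ℕ} {Φ Ψ : BeliefState K → (Fin K → ℝ) → ℝ} {R0 : Fin K → ℕ+ → ℝ} {R1 W β : ℝ}
  {V U : BeliefState K → ℝ}

theorem bellman_le_add (hΦ : IsTopical Φ) (hβ : 0 ≤ β) {c : ℝ} (h : ∀ s, V s ≤ U s + c)
    (s : BeliefState K) :
    bellman Φ R0 R1 W β V s ≤ bellman Φ R0 R1 W β U s + β * c := by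
  refine max_le ?_ ?_
  · have := mul_le_mul_of_nonneg_left (h (s.1, s.2 + 1)) hβ
    have := le_max_left (R0 s.1 s.2 + W + β * U (s.1, s.2 + 1)) (R1 + β * Φ s fun i => U (i, 1))
    simp only [bellman]
    linarith
  · have := mul_le_mul_of_nonneg_left
      (hΦ.le_add s (fun i => V (i, 1)) (fun i => U (i, 1)) c fun i => h _) hβ
    have := le_max_right (R0 s.1 s.2 + W + β * U (s.1, s.2 + 1)) (R1 + β * Φ s fun i => U (i, 1))
    simp only [bellman]
    linarith

theorem bellman_mono_continuation (hβ : 0 ≤ β) (s : BeliefState K)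
    (h : Φ s (fun i => V (i, 1)) ≤ Ψ s fun i => V (i, 1)) :
    bellman Φ R0 R1 W β V s ≤ bellman Ψ R0 R1 W β V s :=
  max_le_max le_rfl (by gcongr)

/-- The comparison principle: bounded subsolutions lie below bounded supersolutions. -/
theorem le_of_le_bellman_of_bellman_le [NeZero K] (hΦ : IsTopical Φ) (hβ : β ∈ Set.Ico (0 : ℝ) 1)
    (hVb : ∃ C, ∀ s, V s ≤ C) (hUb : ∃ C, ∀ s, C ≤ U s)
    (hV : ∀ s, V s ≤ bellman Φ R0 R1 W β V s) (hU : ∀ s, bellman Φ R0 R1 W β U s ≤ U s)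
    (s : BeliefState K) : V s ≤ U s := by
  obtain ⟨C, hC⟩ := hVb
  obtain ⟨C', hC'⟩ := hUb
  have hbdd : BddAbove (Set.range fun s => V s - U s) :=
    ⟨C - C', by rintro _ ⟨s, rfl⟩; exact sub_le_sub (hC s) (hC' s)⟩
  set D := ⨆ s, (V s - U s) with hD
  have hle : ∀ s, V s - U s ≤ D := fun s => le_ciSup hbdd s
  have : Nonempty (BeliefState K) := ⟨s⟩
  -- Since `V ≤ U + D`, one application of the operator shrinks the gap to `β * D`.
  have hDβ : D ≤ β * D := ciSup_le fun s => by
    have := bellman_le_add (R0 := R0) (R1 := R1) (W := W) hΦ hβ.1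
      (fun s => sub_le_iff_le_add'.1 (hle s)) s
    linarith [hV s, hU s]
  have : D ≤ 0 := by nlinarith [hβ.2]
  linarith [hle s]

/-- Banach's fixed point theorem on bounded functions. `R0` may be unbounded below, but the active
branch bounds the maximum from below and `R0 ≤ R1` bounds it from above, so bounded functions stay
bounded. -/
theorem exists_isBellmanSolution [NeZero K] (hΦ : IsTopical Φ) (hβ : β ∈ Set.Ico (0 : ℝ) 1)
    (hR1 : ∀ j τ, R0 j τ ≤ R1) : ∃ V, IsBellmanSolution Φ R0 R1 W β V := by
  have key : ∀ f : BoundedContinuousFunction (BeliefState K) ℝ, ∀ s,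
      ‖bellman Φ R0 R1 W β f s‖ ≤ |R1| + |W| + ‖f‖ := fun f s => by
    have hf : ∀ s, |f s| ≤ ‖f‖ := f.norm_coe_le_norm
    have h1 := hΦ.abs_apply_le s (v := fun i => f (i, 1)) fun i => hf _
    have hb : ∀ x, |x| ≤ ‖f‖ → |β * x| ≤ ‖f‖ := fun x hx => by
      rw [abs_mul, abs_of_nonneg hβ.1]
      exact (mul_le_of_le_one_left (abs_nonneg x) hβ.2.le).trans hx
    have h2 := abs_le.1 (hb _ h1)
    have h3 := abs_le.1 (hb _ (hf (s.1, s.2 + 1)))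
    have := hR1 s.1 s.2
    refine abs_le.2 ⟨le_trans ?_ (le_max_right _ _), max_le ?_ ?_⟩
    · linarith [neg_abs_le R1, abs_nonneg W]
    · linarith [le_abs_self R1, le_abs_self W]
    · linarith [le_abs_self R1, abs_nonneg W]
  let F : BoundedContinuousFunction (BeliefState K) ℝ →
      BoundedContinuousFunction (BeliefState K) ℝ := fun f =>
    BoundedContinuousFunction.ofNormedAddCommGroupDiscrete _ _ (key f)
  have hF : ContractingWith ⟨β, hβ.1⟩ F := by
    refine ⟨by exact_mod_cast hβ.2, LipschitzWith.of_dist_le_mul fun f g => ?_⟩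
    have hfg : ∀ f g : BoundedContinuousFunction (BeliefState K) ℝ, ∀ s,
        bellman Φ R0 R1 W β f s ≤ bellman Φ R0 R1 W β g s + β * dist f g := fun f g =>
      bellman_le_add hΦ hβ.1 fun s => by
        have := (abs_le.1 (BoundedContinuousFunction.dist_coe_le_dist (f := f) (g := g) s)).2
        linarith
    refine (BoundedContinuousFunction.dist_le (mul_nonneg hβ.1 dist_nonneg)).2 fun s => ?_
    have h1 := hfg f g s
    have h2 := hfg g f s
    rw [dist_comm g f] at h2
    have h3 : |bellman Φ R0 R1 W β f s - bellman Φ R0 R1 W β g s| ≤ β * dist f g :=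
      abs_le.2 ⟨by linarith, by linarith⟩
    exact h3
  have hfix := hF.fixedPoint_isFixedPt
  exact ⟨hF.fixedPoint, ⟨_, (hF.fixedPoint).norm_coe_le_norm⟩, fun s =>
    (DFunLike.congr_fun hfix s).symm⟩

theorem IsBellmanSolution.bddAbove (h : IsBellmanSolution Φ R0 R1 W β V) : ∃ C, ∀ s, V s ≤ C :=
  let ⟨C, hC⟩ := h.1
  ⟨C, fun s => (abs_le.1 (hC s)).2⟩

theorem IsBellmanSolution.bddBelow (h : IsBellmanSolution Φ R0 R1 W β V) : ∃ C, ∀ s, C ≤ V s :=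
  let ⟨C, hC⟩ := h.1
  ⟨-C, fun s => (abs_le.1 (hC s)).1⟩

theorem IsBellmanSolution.unique [NeZero K] (hΦ : IsTopical Φ) (hβ : β ∈ Set.Ico (0 : ℝ) 1)
    (hV : IsBellmanSolution Φ R0 R1 W β V) (hU : IsBellmanSolution Φ R0 R1 W β U) : V = U :=
  funext fun s => le_antisymm
    (le_of_le_bellman_of_bellman_le hΦ hβ hV.bddAbove hU.bddBelow (fun s => (hV.2 s).le)
      (fun s => (hU.2 s).ge) s)
    (le_of_le_bellman_of_bellman_le hΦ hβ hU.bddAbove hV.bddBelow (fun s => (hU.2 s).le)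
      (fun s => (hV.2 s).ge) s)

theorem existsUnique_isBellmanSolution [NeZero K] (hΦ : IsTopical Φ)
    (hβ : β ∈ Set.Ico (0 : ℝ) 1) (hR1 : ∀ j τ, R0 j τ ≤ R1) :
    ∃! V, IsBellmanSolution Φ R0 R1 W β V :=
  let ⟨V, hV⟩ := exists_isBellmanSolution hΦ hβ hR1
  ⟨V, hV, fun _ hU => hU.unique hΦ hβ hV⟩

/-- A solution for the smaller continuation is a subsolution for the larger one, so comparison
applies. -/
theorem IsBellmanSolution.le_of_continuation_le [NeZero K] (hΨ : IsTopical Ψ)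
    (hβ : β ∈ Set.Ico (0 : ℝ) 1) (hV : IsBellmanSolution Φ R0 R1 W β V)
    (hU : IsBellmanSolution Ψ R0 R1 W β U) (h : ∀ s v, Φ s v ≤ Ψ s v) (s : BeliefState K) :
    V s ≤ U s :=
  le_of_le_bellman_of_bellman_le hΨ hβ hV.bddAbove hU.bddBelow
    (fun s => (hV.2 s).le.trans (bellman_mono_continuation hβ.1 s (h _ _)))
    (fun s => (hU.2 s).ge) s

theorem isMaxValue_iff : IsMaxValue R0 R1 W β V ↔
    IsBellmanSolution (fun _ v => ⨆ i, v i) R0 R1 W β V :=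
  and_congr Iff.rfl ⟨fun h s => h s.1 s.2, fun h j τ => h (j, τ)⟩

theorem isMinValue_iff : IsMinValue R0 R1 W β V ↔
    IsBellmanSolution (fun _ v => ⨅ i, v i) R0 R1 W β V :=
  and_congr Iff.rfl ⟨fun h s => h s.1 s.2, fun h j τ => h (j, τ)⟩

end Bellman

/-! ### Verification: from Bellman inequalities to policies. -/

section Policies

variable {K : ℕ} {ρ : BeliefState K → Fin K → ℝ} {R0 : Fin K → ℕ+ → ℝ} {R1 W β : ℝ}

/-- The expectation of `f` over the next belief state under the action `a` in the state `s`. -/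
def nextExp (ρ : BeliefState K → Fin K → ℝ) (a : Bool) (s : BeliefState K)
    (f : BeliefState K → ℝ) : ℝ :=
  ∑' s', trans ρ a s s' * f s'

@[simp] theorem nextExp_false (s : BeliefState K) (f : BeliefState K → ℝ) :
    nextExp ρ false s f = f (s.1, s.2 + 1) := tsum_trans_false ρ s f

@[simp] theorem nextExp_true (s : BeliefState K) (f : BeliefState K → ℝ) :
    nextExp ρ true s f = ∑ i, ρ s i * f (i, 1) := tsum_trans_true ρ s f

theorem nextExp_const (h1 : ∀ s, ∑ i, ρ s i = 1) (a : Bool) (s : BeliefState K) (c : ℝ) :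
    nextExp ρ a s (fun _ => c) = c := by
  cases a <;> simp [← Finset.sum_mul, h1]

theorem nextExp_le_add (h0 : ∀ s i, 0 ≤ ρ s i) (h1 : ∀ s, ∑ i, ρ s i = 1) (a : Bool)
    (s : BeliefState K) {f g : BeliefState K → ℝ} {c : ℝ} (h : ∀ s, f s ≤ g s + c) :
    nextExp ρ a s f ≤ nextExp ρ a s g + c := by
  cases a
  · simpa using h _
  · simpa using (isTopical_sum h0 h1).le_add s _ _ c fun i => h (i, 1)

theorem nextExp_sum (a : Bool) (s : BeliefState K) (T : ℕ) (c : ℕ → ℝ)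
    (f : ℕ → BeliefState K → ℝ) :
    nextExp ρ a s (fun s' => ∑ t ∈ Finset.range T, c t * f t s') =
      ∑ t ∈ Finset.range T, c t * nextExp ρ a s (f t) := by
  cases a
  · simp
  · simp only [nextExp_true, Finset.mul_sum]
    rw [Finset.sum_comm]
    exact Finset.sum_congr rfl fun t _ => Finset.sum_congr rfl fun i _ => by ring

/-- The expected discounted reward of the first `T` slots. -/
def partialReward (ρ : BeliefState K → Fin K → ℝ) (R0 : Fin K → ℕ+ → ℝ) (R1 W β : ℝ)
    (φ : Policy K) (T : ℕ) (h : List (BeliefState K)) (s : BeliefState K) : ℝ :=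
  ∑ t ∈ Finset.range T, β ^ t * expectedReward ρ R0 R1 W φ t h s

theorem partialReward_succ (φ : Policy K) (T : ℕ) (h : List (BeliefState K))
    (s : BeliefState K) :
    partialReward ρ R0 R1 W β φ (T + 1) h s = reward R0 R1 W (φ h s) s +
      β * nextExp ρ (φ h s) s (partialReward ρ R0 R1 W β φ T (s :: h)) := by
  unfold partialReward
  rw [Finset.sum_range_succ', nextExp_sum, Finset.mul_sum, add_comm]
  congr 1
  · simp [expectedReward]
  · exact Finset.sum_congr rfl fun t _ => by
      rw [pow_succ', mul_assoc]; rfl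

/-- Induction on the horizon. The parameters serve two purposes: `G = 0` gives the discounted
problem, while `β = 1` gives the average one with gain `G` and relative value `V`. The term `β ^ T *
C` pays for the value of `V` left at the horizon. -/
theorem partialReward_le (h0 : ∀ s i, 0 ≤ ρ s i) (h1 : ∀ s, ∑ i, ρ s i = 1) (hβ : 0 ≤ β)
    {V : BeliefState K → ℝ} {G C : ℝ}
    (hV : ∀ a s, reward R0 R1 W a s + β * nextExp ρ a s V ≤ V s + G) (hC : ∀ s, -C ≤ V s)
    (φ : Policy K) (T : ℕ) (h : List (BeliefState K)) (s : BeliefState K) :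
    partialReward ρ R0 R1 W β φ T h s ≤ V s + (∑ t ∈ Finset.range T, β ^ t) * G + β ^ T * C := by
  induction T generalizing h s with
  | zero => simp [partialReward]; linarith [hC s]
  | succ T ih =>
    rw [partialReward_succ, Finset.sum_range_succ']
    have := mul_le_mul_of_nonneg_left (nextExp_le_add h0 h1 (φ h s) s
      (c := (∑ t ∈ Finset.range T, β ^ t) * G + β ^ T * C)
      fun s' => (ih (s :: h) s').trans_eq (add_assoc _ _ _)) hβ
    have h2 := hV (φ h s) s
    have : β * ((∑ t ∈ Finset.range T, β ^ t) * G) =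
        (∑ t ∈ Finset.range T, β ^ (t + 1)) * G := by
      rw [← mul_assoc, Finset.mul_sum]
      simp only [pow_succ']
    rw [pow_succ', pow_zero]
    linarith

/-- The mirror image, for the stationary policy `d` that picks in each state an action satisfying
the inequality. -/
theorem le_partialReward (h0 : ∀ s i, 0 ≤ ρ s i) (h1 : ∀ s, ∑ i, ρ s i = 1) (hβ : 0 ≤ β)
    {V : BeliefState K → ℝ} {G C : ℝ} {d : BeliefState K → Bool}
    (hV : ∀ s, V s + G ≤ reward R0 R1 W (d s) s + β * nextExp ρ (d s) s V) (hC : ∀ s, V s ≤ C)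
    (T : ℕ) (h : List (BeliefState K)) (s : BeliefState K) :
    V s + (∑ t ∈ Finset.range T, β ^ t) * G - β ^ T * C ≤
      partialReward ρ R0 R1 W β (fun _ => d) T h s := by
  induction T generalizing h s with
  | zero => simp [partialReward]; linarith [hC s]
  | succ T ih =>
    rw [partialReward_succ, Finset.sum_range_succ']
    have := mul_le_mul_of_nonneg_left (nextExp_le_add h0 h1 (d s) s (f := V)
      (g := partialReward ρ R0 R1 W β (fun _ => d) T (s :: h))
      (c := -((∑ t ∈ Finset.range T, β ^ t) * G - β ^ T * C))
      fun s' => by linarith [ih (s :: h) s']) hβ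
    have h2 := hV s
    have : β * ((∑ t ∈ Finset.range T, β ^ t) * G) =
        (∑ t ∈ Finset.range T, β ^ (t + 1)) * G := by
      rw [← mul_assoc, Finset.mul_sum]
      simp only [pow_succ']
    rw [pow_succ', pow_zero]
    linarith

theorem discountedValue_le (h0 : ∀ s i, 0 ≤ ρ s i) (h1 : ∀ s, ∑ i, ρ s i = 1)
    (hβ : β ∈ Set.Ico (0 : ℝ) 1) {V : BeliefState K → ℝ} (hb : ∃ C, ∀ s, C ≤ V s)
    (hV : ∀ a s, reward R0 R1 W a s + β * nextExp ρ a s V ≤ V s) (s : BeliefState K) :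
    discountedValue ρ R0 R1 W β s ≤ (V s : EReal) := by
  obtain ⟨C, hC⟩ := hb
  have hlim : Tendsto (fun T : ℕ => V s + β ^ T * (-C)) atTop (𝓝 (V s)) := by
    simpa using ((tendsto_pow_atTop_nhds_zero_of_lt_one hβ.1 hβ.2).mul_const (-C)).const_add (V s)
  have hlim' := (continuous_coe_real_ereal.tendsto _).comp hlim
  refine iSup_le fun φ => ?_
  rw [← hlim'.liminf_eq]
  refine liminf_le_liminf (Eventually.of_forall fun T => EReal.coe_le_coe_iff.2 ?_)
  simpa [partialReward] using partialReward_le (G := 0) (C := -C) h0 h1 hβ.1 (by simpa using hV)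
    (by simpa using hC) φ T [] s

theorem le_discountedValue (h0 : ∀ s i, 0 ≤ ρ s i) (h1 : ∀ s, ∑ i, ρ s i = 1)
    (hβ : β ∈ Set.Ico (0 : ℝ) 1) {V : BeliefState K → ℝ} (hb : ∃ C, ∀ s, V s ≤ C)
    (hV : ∀ s, ∃ a, V s ≤ reward R0 R1 W a s + β * nextExp ρ a s V) (s : BeliefState K) :
    (V s : EReal) ≤ discountedValue ρ R0 R1 W β s := by
  obtain ⟨C, hC⟩ := hb
  choose d hd using hV
  have hlim : Tendsto (fun T : ℕ => V s - β ^ T * C) atTop (𝓝 (V s)) := by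
    simpa using ((tendsto_pow_atTop_nhds_zero_of_lt_one hβ.1 hβ.2).mul_const C).const_sub (V s)
  have hlim' := (continuous_coe_real_ereal.tendsto _).comp hlim
  refine le_iSup_of_le (fun _ => d) ?_
  rw [← hlim'.liminf_eq]
  refine liminf_le_liminf (Eventually.of_forall fun T => EReal.coe_le_coe_iff.2 ?_)
  simpa [partialReward] using le_partialReward (G := 0) h0 h1 hβ.1 (by simpa using hd) hC T [] s

theorem tendsto_affine_div (a b G : ℝ) :
    Tendsto (fun T : ℕ => (a + T * G + b) / T) atTop (𝓝 G) := by
  have h : Tendsto (fun T : ℕ => (a + b) / (T : ℝ) + G) atTop (𝓝 G) := by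
    simpa using (tendsto_const_div_atTop_nhds_zero_nat (a + b)).add_const G
  refine h.congr' ?_
  filter_upwards [eventually_ne_atTop 0] with T hT
  have : (T : ℝ) ≠ 0 := by exact_mod_cast hT
  field_simp
  ring

theorem optimalAverage_le (h0 : ∀ s i, 0 ≤ ρ s i) (h1 : ∀ s, ∑ i, ρ s i = 1)
    {V : BeliefState K → ℝ} {G : ℝ} (hb : ∃ C, ∀ s, C ≤ V s)
    (hV : ∀ a s, reward R0 R1 W a s + nextExp ρ a s V ≤ V s + G) (s : BeliefState K) :
    optimalAverage ρ R0 R1 W s ≤ (G : EReal) := by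
  obtain ⟨C, hC⟩ := hb
  have hlim' := (continuous_coe_real_ereal.tendsto _).comp (tendsto_affine_div (V s) (-C) G)
  refine iSup_le fun φ => ?_
  rw [← hlim'.liminf_eq]
  refine liminf_le_liminf (Eventually.of_forall fun T => EReal.coe_le_coe_iff.2 ?_)
  refine div_le_div_of_nonneg_right ?_ (Nat.cast_nonneg T)
  simpa [partialReward] using partialReward_le (β := 1) (C := -C) h0 h1 zero_le_one
    (by simpa using hV) (by simpa using hC) φ T [] s

theorem le_optimalAverage (h0 : ∀ s i, 0 ≤ ρ s i) (h1 : ∀ s, ∑ i, ρ s i = 1)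
    {V : BeliefState K → ℝ} {G : ℝ} (hb : ∃ C, ∀ s, V s ≤ C)
    (hV : ∀ s, ∃ a, V s + G ≤ reward R0 R1 W a s + nextExp ρ a s V) (s : BeliefState K) :
    (G : EReal) ≤ optimalAverage ρ R0 R1 W s := by
  obtain ⟨C, hC⟩ := hb
  choose d hd using hV
  have hlim' := (continuous_coe_real_ereal.tendsto _).comp (tendsto_affine_div (V s) (-C) G)
  refine le_iSup_of_le (fun _ => d) ?_
  rw [← hlim'.liminf_eq]
  refine liminf_le_liminf (Eventually.of_forall fun T => EReal.coe_le_coe_iff.2 ?_)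
  refine div_le_div_of_nonneg_right ?_ (Nat.cast_nonneg T)
  have := le_partialReward (β := 1) h0 h1 zero_le_one (by simpa using hd) hC T [] s
  simpa [partialReward, sub_eq_add_neg] using this

theorem reward_add_nextExp_le_bellman (V : BeliefState K → ℝ) (a : Bool) (s : BeliefState K) :
    reward R0 R1 W a s + β * nextExp ρ a s V ≤
      bellman (fun s v => ∑ i, ρ s i * v i) R0 R1 W β V s := by
  cases a
  · simp [reward, bellman]
  · simp [reward, bellman]

theorem exists_reward_add_nextExp_eq_bellman (V : BeliefState K → ℝ) (s : BeliefState K) :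
    ∃ a, bellman (fun s v => ∑ i, ρ s i * v i) R0 R1 W β V s =
      reward R0 R1 W a s + β * nextExp ρ a s V := by
  rcases max_choice (R0 s.1 s.2 + W + β * V (s.1, s.2 + 1)) (R1 + β * ∑ i, ρ s i * V (i, 1))
    with h | h
  · exact ⟨false, by simpa [reward, bellman] using h⟩
  · exact ⟨true, by simpa [reward, bellman] using h⟩

/-- A solution of the discounted Bellman equation whose oscillation is at most `C` determines the
optimal average reward up to an error of `(1 - β) C`. -/
theorem optimalAverage_mem_Icc (h0 : ∀ s i, 0 ≤ ρ s i) (h1 : ∀ s, ∑ i, ρ s i = 1)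
    (hβ : β < 1) {V : BeliefState K → ℝ} {v C : ℝ}
    (hV : IsBellmanSolution (fun s v => ∑ i, ρ s i * v i) R0 R1 W β V)
    (hC : ∀ s, |V s - v| ≤ C) (s : BeliefState K) :
    optimalAverage ρ R0 R1 W s ∈ Set.Icc (((1 - β) * v - (1 - β) * C : ℝ) : EReal)
      ((1 - β) * v + (1 - β) * C : ℝ) := by
  -- Replacing `β * nextExp` by `nextExp` in the Bellman equation adds `(1 - β) * nextExp ρ a s V`,
  -- which lies within `(1 - β) * C` of `(1 - β) * v`. So `V` itself serves as relative value
  -- function.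
  have hup : ∀ a s, nextExp ρ a s V ≤ v + C := fun a s => by
    have := nextExp_le_add h0 h1 a s (f := V) (g := fun _ => v) (c := C)
      fun s => by linarith [(abs_le.1 (hC s)).2]
    simpa [nextExp_const h1] using this
  have hlo : ∀ a s, v - C ≤ nextExp ρ a s V := fun a s => by
    have := nextExp_le_add h0 h1 a s (f := fun _ => v) (g := V) (c := C)
      fun s => by linarith [(abs_le.1 (hC s)).1]
    simpa [nextExp_const h1] using this
  constructor
  · refine le_optimalAverage h0 h1 hV.bddAbove (fun s => ?_) s
    obtain ⟨a, ha⟩ := exists_reward_add_nextExp_eq_bellman (ρ := ρ) (R0 := R0) (R1 := R1) (W := W)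
      (β := β) V s
    rw [← hV.2 s] at ha
    exact ⟨a, by nlinarith [hlo a s]⟩
  · refine optimalAverage_le h0 h1 hV.bddBelow (fun a s => ?_) s
    have ha := reward_add_nextExp_le_bellman (ρ := ρ) (R0 := R0) (R1 := R1) (W := W)
      (β := β) V a s
    rw [← hV.2 s] at ha
    nlinarith [hup a s]

end Policies

/-! ### Bounds on solutions and their oscillation, uniform in the discount factor. -/

section Estimates

variable {K : ℕ} {Φ : BeliefState K → (Fin K → ℝ) → ℝ} {R0 : Fin K → ℕ+ → ℝ} {R1 W β : ℝ}
  {V : BeliefState K → ℝ}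

/-- A discounted maximum principle along the passive action. -/
theorem le_of_le_max_mul_succ {d : ℕ+ → ℝ} {c : ℝ} (hβ : β ∈ Set.Ico (0 : ℝ) 1) (hc : 0 ≤ c)
    (hd : ∃ C, ∀ τ, d τ ≤ C) (h : ∀ τ, d τ ≤ max (β * d (τ + 1)) c) (τ : ℕ+) : d τ ≤ c := by
  obtain ⟨C, hC⟩ := hd
  have hbdd : BddAbove (Set.range d) := ⟨C, by rintro _ ⟨τ, rfl⟩; exact hC τ⟩
  have hle : ∀ τ, d τ ≤ ⨆ σ, d σ := le_ciSup hbdd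
  have hS : (⨆ σ, d σ) ≤ max (β * ⨆ σ, d σ) c := ciSup_le fun τ =>
    (h τ).trans (max_le_max (mul_le_mul_of_nonneg_left (hle _) hβ.1) le_rfl)
  rcases le_max_iff.1 hS with h' | h'
  · have : (⨆ σ, d σ) ≤ 0 := by nlinarith [hβ.2]
    exact (hle τ).trans (this.trans hc)
  · exact (hle τ).trans h'

theorem IsBellmanSolution.passive_le (hV : IsBellmanSolution Φ R0 R1 W β V) (s : BeliefState K) :
    R0 s.1 s.2 + W + β * V (s.1, s.2 + 1) ≤ V s :=
  (le_max_left _ _).trans (hV.2 s).ge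

theorem IsBellmanSolution.active_le (hV : IsBellmanSolution Φ R0 R1 W β V) (s : BeliefState K) :
    R1 + β * Φ s (fun i => V (i, 1)) ≤ V s :=
  (le_max_right _ _).trans (hV.2 s).ge

/-- No slot pays more than `R1 + |W|`, so the constant `(R1 + |W|) / (1 - β)` is a supersolution. -/
theorem IsBellmanSolution.mul_le [NeZero K] (hΦ : IsTopical Φ) (hβ : β ∈ Set.Ico (0 : ℝ) 1)
    (hR1 : ∀ j τ, R0 j τ ≤ R1) (hV : IsBellmanSolution Φ R0 R1 W β V) (s : BeliefState K) :
    (1 - β) * V s ≤ R1 + |W| := by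
  have hpos : 0 < 1 - β := sub_pos.2 hβ.2
  rw [mul_comm, ← le_div_iff₀ hpos]
  set c := (R1 + |W|) / (1 - β) with hc
  have hc' : R1 + |W| = c - β * c := by rw [hc]; field_simp
  refine le_of_le_bellman_of_bellman_le (U := fun _ => c) hΦ hβ hV.bddAbove ⟨c, fun _ => le_rfl⟩
    (fun s => (hV.2 s).le) (fun s => max_le ?_ ?_) s
  · have := hR1 s.1 s.2
    dsimp only
    linarith [le_abs_self W]
  · have := mul_le_mul_of_nonneg_left (hΦ.le_const s (v := fun _ => c) fun _ => le_rfl) hβ.1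
    linarith [abs_nonneg W]

/-- The value `R1 / (1 - β)` of permanent activity is a subsolution. -/
theorem IsBellmanSolution.le_mul [NeZero K] (hΦ : IsTopical Φ) (hβ : β ∈ Set.Ico (0 : ℝ) 1)
    (hV : IsBellmanSolution Φ R0 R1 W β V) (s : BeliefState K) : R1 ≤ (1 - β) * V s := by
  have hpos : 0 < 1 - β := sub_pos.2 hβ.2
  rw [mul_comm, ← div_le_iff₀ hpos]
  set c := R1 / (1 - β) with hc
  have hc' : R1 = c - β * c := by rw [hc]; field_simp
  refine le_of_le_bellman_of_bellman_le (V := fun _ => c) hΦ hβ ⟨c, fun _ => le_rfl⟩ hV.bddBelow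
    (fun s => le_trans ?_ (le_max_right _ _)) (fun s => (hV.2 s).ge) s
  have := mul_le_mul_of_nonneg_left (hΦ.const_le s (v := fun _ => c) fun _ => le_rfl) hβ.1
  linarith

/-- The oscillation of a solution is controlled by its oscillation on the states `(i, 1)`. -/
theorem IsBellmanSolution.abs_sub_le [NeZero K] (hΦ : IsTopical Φ) (hβ : β ∈ Set.Ico (0 : ℝ) 1)
    (hR0 : ∀ j, Antitone (R0 j)) (hR1 : ∀ j τ, R0 j τ ≤ R1)
    (hV : IsBellmanSolution Φ R0 R1 W β V) {M C : ℝ}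
    (hM : ∀ i, V (i, 1) ≤ M) (hC : ∀ i, M - C ≤ V (i, 1)) (s s' : BeliefState K) :
    |V s - V s'| ≤ 2 * (C + |W|) := by
  have hC0 : 0 ≤ C := by linarith [hM 0, hC 0]
  have hΦM : ∀ s, Φ s (fun i => V (i, 1)) ≤ M := fun s => hΦ.le_const s hM
  have hΦC : ∀ s, M - C ≤ Φ s fun i => V (i, 1) := fun s => hΦ.const_le s hC
  have hup : ∀ s, V s ≤ M + C := by
    rintro ⟨j, τ⟩
    rcases eq_or_ne τ 1 with rfl | hτ
    · linarith [hM j]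
    obtain ⟨σ, rfl⟩ := PNat.exists_eq_succ_of_ne_one hτ
    obtain ⟨A, hA⟩ := hV.bddAbove
    obtain ⟨A', hA'⟩ := hV.bddBelow
    -- An older belief earns no more when passive, and active continuations differ by at most `C`.
    -- So the gain from being `σ` slots older satisfies the maximum principle; at `τ = 1` it
    -- compares `(j, σ + 1)` with `(j, 1)`.
    have := le_of_le_max_mul_succ (d := fun τ => V (j, σ + τ) - V (j, τ)) hβ hC0
      ⟨A - A', fun τ => sub_le_sub (hA _) (hA' _)⟩ (fun τ => ?_) 1
    · linarith [hM j]
    · rw [hV.2 (j, σ + τ), hV.2 (j, τ)]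
      refine (max_sub_max_le_max _ _ _ _).trans (max_le_max ?_ ?_)
      · have := hR0 j (PNat.lt_add_left τ σ).le
        dsimp only
        rw [← add_assoc σ τ 1]
        linarith
      · have h1 := mul_le_mul_of_nonneg_left (hΦM (j, σ + τ)) hβ.1
        have h2 := mul_le_mul_of_nonneg_left (hΦC (j, τ)) hβ.1
        have := mul_le_of_le_one_left hC0 hβ.2.le
        linarith
  -- Being active at once gives at least `R1 + β * (M - C)`, and `(1 - β) * (M - C)` is at most `R1
  -- + |W|`.
  have hlo : ∀ s, M - C - |W| ≤ V s := fun s => by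
    have h1 := hV.active_le s
    have h2 := mul_le_mul_of_nonneg_left (hΦC s) hβ.1
    have h3 := hV.mul_le hΦ hβ hR1 (0, 1)
    have h4 := mul_le_mul_of_nonneg_left (hC 0) (sub_pos.2 hβ.2).le
    linarith
  exact abs_le.2 ⟨by linarith [hup s', hlo s, abs_nonneg W],
    by linarith [hup s, hlo s', abs_nonneg W]⟩

/-- One active slot leads to the best state `(k, 1)`, so every `(i, 1)` loses at most `|W|` against
it. -/
theorem IsBellmanSolution.abs_sub_le_of_iSup [NeZero K] (hβ : β ∈ Set.Ico (0 : ℝ) 1)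
    (hR0 : ∀ j, Antitone (R0 j)) (hR1 : ∀ j τ, R0 j τ ≤ R1)
    (hV : IsBellmanSolution (fun _ v => ⨆ i, v i) R0 R1 W β V) (s s' : BeliefState K) :
    |V s - V s'| ≤ 2 * (|W| + |W|) := by
  obtain ⟨k, hk⟩ := Finite.exists_max fun i => V (i, 1)
  have hM : ⨆ i, V (i, 1) = V (k, 1) :=
    le_antisymm (ciSup_le hk) (le_ciSup (Set.finite_range fun i => V (i, 1)).bddAbove k)
  refine hV.abs_sub_le isTopical_iSup hβ hR0 hR1 hk (fun i => ?_) s s'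
  have h1 := hV.active_le (i, 1)
  have h2 := hV.mul_le isTopical_iSup hβ hR1 (k, 1)
  rw [hM] at h1
  linarith

theorem pow_mulVec_le {Q : Matrix (Fin K) (Fin K) ℝ} (hQ : Q ∈ rowStochastic ℝ (Fin K))
    (hβ : 0 ≤ β) {v : Fin K → ℝ} (h : ∀ i, β * (Q *ᵥ v) i ≤ v i) (n : ℕ) (i : Fin K) :
    β ^ n * ((Q ^ n) *ᵥ v) i ≤ v i := by
  induction n generalizing i with
  | zero => simp
  | succ n ih =>
    refine le_trans ?_ (h i)
    rw [pow_succ', pow_succ', ← mulVec_mulVec, mul_assoc]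
    refine mul_le_mul_of_nonneg_left ?_ hβ
    have hsmul : β ^ n * (Q *ᵥ ((Q ^ n) *ᵥ v)) i = (Q *ᵥ (β ^ n • ((Q ^ n) *ᵥ v))) i := by
      rw [mulVec_smul]; rfl
    rw [hsmul]
    change ∑ k, Q i k * (β ^ n * ((Q ^ n) *ᵥ v) k) ≤ ∑ k, Q i k * v k
    exact Finset.sum_le_sum fun k _ =>
      mul_le_mul_of_nonneg_left (ih k) (nonneg_of_mem_rowStochastic hQ)

/-- Permanent activity moves the worst state `l` to the best state `k` in `N` steps with probability
`p > 0`. If `V (k, 1)` were far above `V (l, 1)`, this would make `V (l, 1)` too large. Only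
finitely many pairs occur, and `β ≥ 1 / 2` keeps `β ^ N` away from `0`. -/
theorem exists_abs_sub_le_of_irreducible [NeZero K] {ρ : BeliefState K → Fin K → ℝ}
    (h0 : ∀ s i, 0 ≤ ρ s i) (h1 : ∀ s, ∑ i, ρ s i = 1)
    (hirr : ∀ i k, ∃ n : ℕ, 0 < ((Matrix.of fun i k => ρ (i, 1) k) ^ n) i k)
    (hR0 : ∀ j, Antitone (R0 j)) (hR1 : ∀ j τ, R0 j τ ≤ R1) :
    ∃ C, ∀ β ∈ Set.Ico (1 / 2 : ℝ) 1, ∀ V : BeliefState K → ℝ,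
      IsBellmanSolution (fun s v => ∑ i, ρ s i * v i) R0 R1 W β V →
      ∀ s s', |V s - V s'| ≤ C := by
  choose n hn using hirr
  set Q : Matrix (Fin K) (Fin K) ℝ := Matrix.of fun i k => ρ (i, 1) k with hQdef
  have hQ : Q ∈ rowStochastic ℝ (Fin K) :=
    mem_rowStochastic_iff_sum.2 ⟨fun i k => h0 _ _, fun i => h1 _⟩
  obtain ⟨C, hC⟩ := (Set.finite_range fun x : Fin K × Fin K =>
    n x.1 x.2 * |W| * 2 ^ n x.1 x.2 / (Q ^ n x.1 x.2) x.1 x.2).bddAbove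
  refine ⟨2 * (C + |W|), fun β hβ' V hV => ?_⟩
  have hβ : β ∈ Set.Ico (0 : ℝ) 1 := ⟨by linarith [hβ'.1], hβ'.2⟩
  have hpos : 0 < 1 - β := sub_pos.2 hβ.2
  have hΦ := isTopical_sum h0 h1
  obtain ⟨k, hk⟩ := Finite.exists_max fun i => V (i, 1)
  obtain ⟨l, hl⟩ := Finite.exists_min fun i => V (i, 1)
  refine hV.abs_sub_le hΦ hβ hR0 hR1 hk fun i => ?_
  refine le_trans ?_ (hl i)
  -- Subtracting the value of permanent activity removes `R1`: the active branch says exactly `β * Q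
  -- v ≤ v`.
  set c := R1 / (1 - β) with hc
  have hc' : R1 = c - β * c := by rw [hc]; field_simp
  set v : Fin K → ℝ := fun i => V (i, 1) - c with hv
  have hQn := pow_mem hQ (n l k)
  set N := n l k with hN
  set p := (Q ^ N) l k with hp
  have hp0 : 0 < p := hn l k
  have hQv : ∀ i, (Q *ᵥ v) i = ∑ x, ρ (i, 1) x * V (x, 1) - c := fun i => by
    simp only [mulVec, dotProduct, hv, mul_sub, Finset.sum_sub_distrib, ← Finset.sum_mul]
    simp [hQdef, h1]
  have hsuper := pow_mulVec_le hQ hβ.1 (v := v) (fun i => by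
    have := hV.active_le (i, 1)
    rw [hQv, hv]
    linarith) N l
  have hvl : 0 ≤ v l := by
    have := hV.le_mul hΦ hβ (l, 1)
    rw [mul_comm, ← div_le_iff₀ hpos] at this
    exact sub_nonneg.2 this
  have hW : (1 - β) * v l ≤ |W| := by
    have := hV.mul_le hΦ hβ hR1 (l, 1)
    rw [hv]
    linarith
  have hmix : p * (v k - v l) + v l ≤ ((Q ^ N) *ᵥ v) l := by
    have h2 : p * (v k - v l) ≤ ∑ x, (Q ^ N) l x * (v x - v l) :=
      Finset.single_le_sum (f := fun x => (Q ^ N) l x * (v x - v l))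
        (fun x _ => mul_nonneg (nonneg_of_mem_rowStochastic hQn)
          (by simp only [hv]; linarith [hl x])) (Finset.mem_univ k)
    simp only [mul_sub, Finset.sum_sub_distrib, ← Finset.sum_mul,
      sum_row_of_mem_rowStochastic hQn] at h2
    simp only [mulVec, dotProduct]
    linarith
  -- Since `v l` is only known to be at most `|W| / (1 - β)`, the loss `1 - β ^ N` must be bounded
  -- by a multiple of `1 - β`.
  have hbern : 1 - N * (1 - β) ≤ β ^ N := by
    have := one_add_mul_le_pow (a := β - 1) (by linarith [hβ.1]) N
    rw [add_sub_cancel] at this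
    linarith
  have hβN : (1 / 2 : ℝ) ^ N ≤ β ^ N := pow_le_pow_left₀ (by norm_num) hβ'.1 N
  have hkl : 0 ≤ v k - v l := by simp only [hv]; linarith [hl k]
  have hmain : β ^ N * (p * (v k - v l)) ≤ N * |W| := by
    have h2 := mul_le_mul_of_nonneg_left hmix (pow_nonneg hβ.1 N)
    have h3 := mul_le_mul_of_nonneg_right hbern hvl
    have h4 := mul_le_mul_of_nonneg_left hW (Nat.cast_nonneg (α := ℝ) N)
    linarith
  have hmain' := (mul_le_mul_of_nonneg_right hβN (mul_nonneg hp0.le hkl)).trans hmain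
  have : v k - v l ≤ N * |W| * 2 ^ N / p := by
    rw [le_div_iff₀ hp0]
    rw [one_div, inv_pow, inv_mul_le_iff₀ (by positivity)] at hmain'
    linarith
  have hCle : N * |W| * 2 ^ N / p ≤ C := hC ⟨(l, k), rfl⟩
  simp only [hv] at this
  linarith

end Estimates

/-! ### The vanishing discount limit and the optimal average reward. -/

section VanishingDiscount

variable {K : ℕ} {Φ : BeliefState K → (Fin K → ℝ) → ℝ} {R0 : Fin K → ℕ+ → ℝ} {R1 W : ℝ}

/-- Let `D` be the supremum of the difference of the normalized solutions. Comparing the two Bellman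
equations bounds `D` by `D` plus the discount errors minus the difference of the normalized gains;
`D` cancels. -/
theorem IsBellmanSolution.sub_le_of_oscillation [NeZero K] (hΦ : IsTopical Φ) {β β' v v' C : ℝ}
    {V V' : BeliefState K → ℝ} (hβ : β ≤ 1) (hβ' : β' ≤ 1)
    (hV : IsBellmanSolution Φ R0 R1 W β V) (hV' : IsBellmanSolution Φ R0 R1 W β' V')
    (h : ∀ s, |V s - v| ≤ C) (h' : ∀ s, |V' s - v'| ≤ C) :
    (1 - β) * v - (1 - β') * v' ≤ C * ((1 - β) + (1 - β')) := by
  have hbdd : BddAbove (Set.range fun s => (V s - v) - (V' s - v')) :=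
    ⟨C + C, by
      rintro _ ⟨s, rfl⟩
      dsimp only
      linarith [(abs_le.1 (h s)).2, (abs_le.1 (h' s)).1]⟩
  set D := ⨆ s, ((V s - v) - (V' s - v')) with hD
  have hle : ∀ s, (V s - v) - (V' s - v') ≤ D := le_ciSup hbdd
  have key : ∀ a b : ℝ, |a - v| ≤ C → |b - v'| ≤ C → (a - v) - (b - v') ≤ D →
      β * a ≤ β' * b + ((β * v - β' * v') + D + C * ((1 - β) + (1 - β'))) := by
    intro a b ha hb hab
    have h1 := mul_le_mul_of_nonneg_left (abs_le.1 ha).1 (sub_nonneg.2 hβ)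
    have h2 := mul_le_mul_of_nonneg_left (abs_le.1 hb).2 (sub_nonneg.2 hβ')
    linarith
  have hstep : D ≤ D + C * ((1 - β) + (1 - β')) - ((1 - β) * v - (1 - β') * v') :=
    ciSup_le fun s => by
    have hΦs : ∀ {V : BeliefState K → ℝ} {v : ℝ}, (∀ s, |V s - v| ≤ C) →
        |Φ s (fun i => V (i, 1)) - v| ≤ C := fun {V v} h => by
      have h1 := hΦ.le_const s (v := fun i => V (i, 1)) (c := v + C)
        fun i => by linarith [(abs_le.1 (h (i, 1))).2]
      have h2 := hΦ.const_le s (v := fun i => V (i, 1)) (c := v - C)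
        fun i => by linarith [(abs_le.1 (h (i, 1))).1]
      exact abs_le.2 ⟨by linarith, by linarith⟩
    have h1 := key _ _ (h (s.1, s.2 + 1)) (h' (s.1, s.2 + 1)) (hle _)
    have h2 := key _ _ (hΦs h) (hΦs h') (by
      have := hΦ.le_add s (fun i => V (i, 1)) (fun i => V' (i, 1)) (v - v' + D)
        fun i => by linarith [hle (i, 1)]
      linarith)
    have : V s ≤ V' s + ((β * v - β' * v') + D + C * ((1 - β) + (1 - β'))) := by
      rw [hV.2 s]
      exact max_le (by linarith [hV'.passive_le s]) (by linarith [hV'.active_le s])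
    linarith
  linarith

theorem exists_tendsto_of_oscillation [NeZero K] (hΦ : IsTopical Φ) {V : ℝ → BeliefState K → ℝ}
    {C : ℝ} (hV : ∀ β ∈ Set.Ico (0 : ℝ) 1, IsBellmanSolution Φ R0 R1 W β (V β))
    (hC : ∀ β ∈ Set.Ico (1 / 2 : ℝ) 1, ∀ s s', |V β s - V β s'| ≤ C) :
    ∃ g, ∀ s, Tendsto (fun β => (1 - β) * V β s) (𝓝[<] 1) (𝓝 g) := by
  set A : ℝ → ℝ := fun β => (1 - β) * V β (0, 1) with hA
  have hC0 : 0 ≤ C := (abs_nonneg _).trans (hC (1 / 2) ⟨le_rfl, by norm_num⟩ (0, 1) (0, 1))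
  have hsub : ∀ β ∈ Set.Ico (1 / 2 : ℝ) 1, β ∈ Set.Ico (0 : ℝ) 1 :=
    fun β hβ => ⟨by linarith [hβ.1], hβ.2⟩
  have hAA : ∀ β ∈ Set.Ico (1 / 2 : ℝ) 1, ∀ β' ∈ Set.Ico (1 / 2 : ℝ) 1,
      A β - A β' ≤ C * ((1 - β) + (1 - β')) := fun β hβ β' hβ' =>
    (hV β (hsub β hβ)).sub_le_of_oscillation hΦ hβ.2.le hβ'.2.le (hV β' (hsub β' hβ'))
      (fun s => hC β hβ s (0, 1)) fun s => hC β' hβ' s (0, 1)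
  have hcauchy : Cauchy (map A (𝓝[<] 1)) := by
    refine Metric.cauchy_iff.2 ⟨inferInstance, fun ε hε => ?_⟩
    have hδ : 0 < ε / (2 * C + 1) := by positivity
    refine ⟨_, image_mem_map (Ico_mem_nhdsLT
      (max_lt (by norm_num : (1 / 2 : ℝ) < 1) (sub_lt_self 1 hδ))), ?_⟩
    have hlt : ∀ β ∈ Set.Ico (max (1 / 2) (1 - ε / (2 * C + 1))) 1,
        ∀ β' ∈ Set.Ico (max (1 / 2) (1 - ε / (2 * C + 1))) 1, A β - A β' < ε := by
      intro β hβ β' hβ'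
      have h1 := hAA β ⟨(le_max_left _ _).trans hβ.1, hβ.2⟩ β'
        ⟨(le_max_left _ _).trans hβ'.1, hβ'.2⟩
      have h2 := (le_max_right _ _).trans hβ.1
      have h3 := (le_max_right _ _).trans hβ'.1
      have h4 : C * ((1 - β) + (1 - β')) ≤ C * (2 * (ε / (2 * C + 1))) :=
        mul_le_mul_of_nonneg_left (by linarith) hC0
      have h5 : (2 * C + 1) * (ε / (2 * C + 1)) = ε := by field_simp
      linarith
    rintro _ ⟨β, hβ, rfl⟩ _ ⟨β', hβ', rfl⟩
    exact abs_sub_lt_iff.2 ⟨hlt β hβ β' hβ', hlt β' hβ' β hβ⟩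
  obtain ⟨g, hg⟩ := cauchy_map_iff_exists_tendsto.1 hcauchy
  refine ⟨g, fun s => ?_⟩
  have hlim : Tendsto (fun β : ℝ => (1 - β) * C) (𝓝[<] 1) (𝓝 0) := by
    have : Tendsto (fun β : ℝ => (1 - β) * C) (𝓝 1) (𝓝 ((1 - 1) * C)) :=
      (by fun_prop : Continuous fun β : ℝ => (1 - β) * C).tendsto 1
    simpa using this.mono_left nhdsWithin_le_nhds
  have hdiff : Tendsto (fun β => (1 - β) * V β s - A β) (𝓝[<] 1) (𝓝 0) := by
    refine squeeze_zero_norm' ?_ hlim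
    filter_upwards [Ico_mem_nhdsLT (by norm_num : (1 / 2 : ℝ) < 1)] with β hβ
    rw [hA, ← mul_sub, Real.norm_eq_abs, abs_mul, abs_of_pos (sub_pos.2 hβ.2)]
    exact mul_le_mul_of_nonneg_left (hC β hβ _ _) (sub_pos.2 hβ.2).le
  simpa using hdiff.add hg

/-- For each `β` near `1` the optimal average lies within `(1 - β) * C` of `(1 - β) * V β s`.
Letting `β → 1` identifies it without solving an average-reward optimality equation. -/
theorem exists_optimalAverage_eq [NeZero K] {ρ : BeliefState K → Fin K → ℝ}
    (h0 : ∀ s i, 0 ≤ ρ s i) (h1 : ∀ s, ∑ i, ρ s i = 1)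
    (hirr : ∀ i k, ∃ n : ℕ, 0 < ((Matrix.of fun i k => ρ (i, 1) k) ^ n) i k)
    (hR0 : ∀ j, Antitone (R0 j)) (hR1 : ∀ j τ, R0 j τ ≤ R1) :
    ∃ (g : ℝ) (V : ℝ → BeliefState K → ℝ),
      (∀ s, optimalAverage ρ R0 R1 W s = (g : EReal)) ∧
      (∀ β ∈ Set.Ico (0 : ℝ) 1,
        IsBellmanSolution (fun s v => ∑ i, ρ s i * v i) R0 R1 W β (V β)) ∧
      ∀ s, Tendsto (fun β => (1 - β) * V β s) (𝓝[<] 1) (𝓝 g) := by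
  have hΦ := isTopical_sum h0 h1
  have hex : ∀ β : ℝ, ∃ V, β ∈ Set.Ico (0 : ℝ) 1 →
      IsBellmanSolution (fun s v => ∑ i, ρ s i * v i) R0 R1 W β V := fun β => by
    by_cases hβ : β ∈ Set.Ico (0 : ℝ) 1
    · obtain ⟨V, hV⟩ := exists_isBellmanSolution (W := W) hΦ hβ hR1
      exact ⟨V, fun _ => hV⟩
    · exact ⟨0, fun h => absurd h hβ⟩
  choose V hV using hex
  obtain ⟨C, hC⟩ := exists_abs_sub_le_of_irreducible (W := W) h0 h1 hirr hR0 hR1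
  have hsub : ∀ β ∈ Set.Ico (1 / 2 : ℝ) 1, β ∈ Set.Ico (0 : ℝ) 1 :=
    fun β hβ => ⟨by linarith [hβ.1], hβ.2⟩
  have hosc := fun β hβ => hC β hβ (V β) (hV β (hsub β hβ))
  obtain ⟨g, hg⟩ := exists_tendsto_of_oscillation hΦ hV hosc
  refine ⟨g, V, fun s => ?_, hV, hg⟩
  have hlim : Tendsto (fun β : ℝ => (1 - β) * C) (𝓝[<] 1) (𝓝 0) := by
    have : Tendsto (fun β : ℝ => (1 - β) * C) (𝓝 1) (𝓝 ((1 - 1) * C)) :=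
      (by fun_prop : Continuous fun β : ℝ => (1 - β) * C).tendsto 1
    simpa using this.mono_left nhdsWithin_le_nhds
  have hmem : ∀ᶠ β in 𝓝[<] (1 : ℝ), optimalAverage ρ R0 R1 W s ∈
      Set.Icc (((1 - β) * V β s - (1 - β) * C : ℝ) : EReal)
        ((1 - β) * V β s + (1 - β) * C : ℝ) := by
    filter_upwards [Ico_mem_nhdsLT (by norm_num : (1 / 2 : ℝ) < 1)] with β hβ
    exact optimalAverage_mem_Icc h0 h1 hβ.2 (hV β (hsub β hβ)) (fun s' => hosc β hβ s' s) s
  refine le_antisymm ?_ ?_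
  · have := (continuous_coe_real_ereal.tendsto _).comp ((hg s).add hlim)
    rw [add_zero] at this
    exact ge_of_tendsto this (hmem.mono fun β h => h.2)
  · have := (continuous_coe_real_ereal.tendsto _).comp ((hg s).sub hlim)
    rw [sub_zero] at this
    exact le_of_tendsto this (hmem.mono fun β h => h.1)

end VanishingDiscount

/-! ### Limits of the maximal and minimal value functions. -/

section MinValue

variable {K : ℕ} {R0 : Fin K → ℕ+ → ℝ} {R1 W : ℝ}

/-- The smallest value of the states `(i, 1)` under `V_β^min` is the smallest value among the
problems in which sensing in state `j` always leads back to `(j, 1)`. -/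
theorem iInf_minValue_eq [NeZero K] {β : ℝ} (hβ : β ∈ Set.Ico (0 : ℝ) 1) {V : BeliefState K → ℝ}
    (hV : IsMinValue R0 R1 W β V) {U : Fin K → BeliefState 1 → ℝ}
    (hU : ∀ j, IsMaxValue (fun _ => R0 j) R1 W β (U j)) :
    ⨅ i, V (i, 1) = ⨅ j, U j (0, 1) := by
  obtain ⟨l, hl⟩ := Finite.exists_min fun i => V (i, 1)
  have hinf : ⨅ i, V (i, 1) = V (l, 1) :=
    le_antisymm (ciInf_le (Set.finite_range fun i => V (i, 1)).bddBelow l) (le_ciInf hl)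
  obtain ⟨C, hC⟩ := hV.1
  have hU' := fun j => isMaxValue_iff.1 (hU j)
  -- With a single state the supremum is trivial. Returning to `(j, 1)` is at least as good as the
  -- worst state, so `V (j, ·)` is a subsolution of that problem.
  have hle : ∀ j, V (j, 1) ≤ U j (0, 1) := fun j => by
    refine le_of_le_bellman_of_bellman_le (V := fun s => V (j, s.2)) isTopical_iSup hβ
      ⟨C, fun s => (abs_le.1 (hC _)).2⟩ (hU' j).bddBelow (fun s => ?_)
      (fun s => ((hU' j).2 s).ge) (0, 1)
    rw [hV.2 j s.2, hinf]
    refine max_le_max le_rfl ?_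
    simpa using mul_le_mul_of_nonneg_left (hl j) hβ.1
  -- The minimizer `l` is its own worst state, so here the equations coincide.
  have heq : (fun s : BeliefState 1 => V (l, s.2)) = U l := by
    refine IsBellmanSolution.unique isTopical_iSup hβ ⟨⟨C, fun s => hC _⟩, fun s => ?_⟩ (hU' l)
    refine (hV.2 l s.2).trans ?_
    rw [hinf]
    simp [bellman]
  rw [hinf]
  refine le_antisymm (le_ciInf fun j => (hl j).trans (hle j)) ?_
  have := congrFun heq (0, 1)
  exact (ciInf_le (Set.finite_range fun j => U j (0, 1)).bddBelow l).trans this.ge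

theorem exists_tendsto_maxValue [NeZero K] (hR0 : ∀ j, Antitone (R0 j))
    (hR1 : ∀ j τ, R0 j τ ≤ R1) {V : ℝ → BeliefState K → ℝ}
    (hV : ∀ β ∈ Set.Ico (0 : ℝ) 1, IsMaxValue R0 R1 W β (V β)) :
    ∃ g, ∀ s, Tendsto (fun β => (1 - β) * V β s) (𝓝[<] 1) (𝓝 g) :=
  exists_tendsto_of_oscillation isTopical_iSup (fun β hβ => isMaxValue_iff.1 (hV β hβ))
    fun β hβ => (isMaxValue_iff.1 (hV β ⟨by linarith [hβ.1], hβ.2⟩)).abs_sub_le_of_iSup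
      ⟨by linarith [hβ.1], hβ.2⟩ hR0 hR1

theorem exists_tendsto_iInf_minValue [NeZero K] (hR0 : ∀ j, Antitone (R0 j))
    (hR1 : ∀ j τ, R0 j τ ≤ R1) {V : ℝ → BeliefState K → ℝ}
    (hV : ∀ β ∈ Set.Ico (0 : ℝ) 1, IsMinValue R0 R1 W β (V β)) :
    ∃ μ, Tendsto (fun β => (1 - β) * ⨅ i, V β (i, 1)) (𝓝[<] 1) (𝓝 μ) := by
  have hex : ∀ (j : Fin K) (β : ℝ), ∃ U : BeliefState 1 → ℝ, β ∈ Set.Ico (0 : ℝ) 1 →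
      IsMaxValue (fun _ => R0 j) R1 W β U := fun j β => by
    by_cases hβ : β ∈ Set.Ico (0 : ℝ) 1
    · obtain ⟨U, hU⟩ := exists_isBellmanSolution (K := 1) (R0 := fun _ => R0 j) (W := W)
        isTopical_iSup hβ fun _ => hR1 j
      exact ⟨U, fun _ => isMaxValue_iff.2 hU⟩
    · exact ⟨0, fun h => absurd h hβ⟩
  choose U hU using hex
  choose x hx using fun j => exists_tendsto_maxValue (fun _ => hR0 j) (fun _ => hR1 j) (hU j)
  refine ⟨Finset.univ.inf' Finset.univ_nonempty x, ?_⟩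
  refine (Tendsto.finset_inf'_nhds_apply Finset.univ_nonempty
    fun j _ => hx j (0, 1)).congr' ?_
  filter_upwards [Ico_mem_nhdsLT (zero_lt_one' ℝ)] with β hβ
  rw [iInf_minValue_eq hβ (hV β hβ) fun j => hU j β hβ, Finset.inf'_univ_eq_ciInf,
    Real.mul_iInf_of_nonneg (sub_pos.2 hβ.2).le]

/-- The upper bound: for `c > L`, beyond some age `N` passivity pays at most `c` per slot, and near
`β = 1` activity is worth at most `c / (1 - β)`, so `V ≤ c / (1 - β)` there. The first `N` slots add
at most `N * (R1 + |W|)`, which vanishes after multiplication by `1 - β`. -/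
theorem tendsto_minValue_of_forall_lt [NeZero K] (hR0 : ∀ j, Antitone (R0 j))
    (hR1 : ∀ j τ, R0 j τ ≤ R1) (hpos : 0 < R1) {V : ℝ → BeliefState K → ℝ}
    (hV : ∀ β ∈ Set.Ico (0 : ℝ) 1, IsMinValue R0 R1 W β (V β)) {μ L : ℝ}
    (hμ : Tendsto (fun β => (1 - β) * ⨅ i, V β (i, 1)) (𝓝[<] 1) (𝓝 μ)) (hμL : μ ≤ L)
    (j : Fin K) (τ : ℕ+) (hL : ∀ c > L, ∃ N, R0 j N + W ≤ c)
    (hlow : ∀ a < L, ∀ᶠ β in 𝓝[<] (1 : ℝ), a < (1 - β) * V β (j, τ)) :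
    Tendsto (fun β => (1 - β) * V β (j, τ)) (𝓝[<] 1) (𝓝 L) := by
  refine tendsto_order.2 ⟨hlow, fun a ha => ?_⟩
  obtain ⟨c, hLc, hca⟩ := exists_between ha
  obtain ⟨N, hN⟩ := hL c hLc
  have hid : Tendsto (fun β : ℝ => β) (𝓝[<] 1) (𝓝 1) := nhdsWithin_le_nhds
  have h1β : Tendsto (fun β : ℝ => 1 - β) (𝓝[<] 1) (𝓝 0) := by
    simpa using hid.const_sub 1
  have hact : ∀ᶠ β in 𝓝[<] (1 : ℝ),
      (1 - β) * R1 + β * ((1 - β) * ⨅ i, V β (i, 1)) < c := by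
    refine ((h1β.mul_const R1).add (hid.mul hμ)).eventually_lt_const ?_
    linarith
  have hB : 0 ≤ R1 + |W| := by positivity
  have hend : ∀ᶠ β in 𝓝[<] (1 : ℝ), c + (1 - β) * (N * (R1 + |W|)) < a := by
    refine ((h1β.mul_const _).const_add c).eventually_lt_const ?_
    linarith
  filter_upwards [hact, hend, Ico_mem_nhdsLT (zero_lt_one' ℝ)] with β h1 h2 hβ
  have hβ1 : 0 < 1 - β := sub_pos.2 hβ.2
  refine lt_of_le_of_lt ?_ h2
  have hs := isMinValue_iff.1 (hV β hβ)
  set m := ⨅ i, V β (i, 1) with hm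
  set u := c / (1 - β) with hu
  have hcu : c = u - β * u := by rw [hu]; field_simp
  have hmu : R1 + β * m ≤ u := by
    rw [hu, le_div_iff₀ hβ1]
    linarith
  have hfar : V β (j, τ + N) ≤ u := by
    obtain ⟨A, hA⟩ := hs.bddAbove
    have := le_of_le_max_mul_succ (d := fun σ => V β (j, σ + N) - u) hβ le_rfl
      ⟨A - u, fun σ => sub_le_sub_right (hA _) _⟩ (fun σ => ?_) τ
    · linarith
    · rw [(hV β hβ).2, add_right_comm σ 1 N, sub_le_iff_le_add]
      refine max_le ?_ ?_
      · have h3 := hR0 j (PNat.lt_add_left N σ).le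
        have h4 := le_max_left (β * (V β (j, σ + N + 1) - u)) 0
        linarith
      · have h4 := le_max_right (β * (V β (j, σ + N + 1) - u)) 0
        linarith
  have hnn : ∀ s, 0 ≤ V β s := fun s => by
    have := hpos.le.trans (hs.le_mul isTopical_iInf hβ s)
    exact nonneg_of_mul_nonneg_right this hβ1
  have hstep : ∀ σ, V β (j, σ) ≤ V β (j, σ + 1) + (R1 + |W|) := fun σ => by
    rw [(hV β hβ).2 j σ]
    refine max_le ?_ ?_
    · have h3 := mul_le_of_le_one_left (hnn (j, σ + 1)) hβ.2.le
      linarith [hR1 j σ, le_abs_self W]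
    · have h3 : R1 + β * m ≤ V β (j, σ + 1) := hs.active_le (j, σ + 1)
      linarith
  have hsteps : ∀ n : ℕ+, V β (j, τ) ≤ V β (j, τ + n) + n * (R1 + |W|) := fun n => by
    induction n using PNat.recOn with
    | one => simpa using hstep τ
    | succ n ih =>
      have h3 := hstep (τ + n)
      rw [add_assoc] at h3
      push_cast
      linarith
  have h3 := mul_le_mul_of_nonneg_left ((hsteps N).trans (add_le_add_left hfar _)) hβ1.le
  linarith

theorem exists_tendsto_minValue [NeZero K] (hR0 : ∀ j, Antitone (R0 j))
    (hR1 : ∀ j τ, R0 j τ ≤ R1) (hpos : 0 < R1) {V : ℝ → BeliefState K → ℝ}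
    (hV : ∀ β ∈ Set.Ico (0 : ℝ) 1, IsMinValue R0 R1 W β (V β)) (s : BeliefState K) :
    ∃ g, Tendsto (fun β => (1 - β) * V β s) (𝓝[<] 1) (𝓝 g) := by
  obtain ⟨μ, hμ⟩ := exists_tendsto_iInf_minValue hR0 hR1 hV
  obtain ⟨j, τ⟩ := s
  have hid : Tendsto (fun β : ℝ => β) (𝓝[<] 1) (𝓝 1) := nhdsWithin_le_nhds
  have hact : ∀ a < μ, ∀ᶠ β in 𝓝[<] (1 : ℝ), a < (1 - β) * V β (j, τ) := fun a ha => by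
    have h1 : Tendsto (fun β : ℝ => (1 - β) * R1 + β * ((1 - β) * ⨅ i, V β (i, 1)))
        (𝓝[<] 1) (𝓝 μ) := by
      simpa using ((hid.const_sub 1).mul_const R1).add (hid.mul hμ)
    filter_upwards [h1.eventually_const_lt ha, Ico_mem_nhdsLT (zero_lt_one' ℝ)] with β h2 hβ
    have h3 := mul_le_mul_of_nonneg_left ((isMinValue_iff.1 (hV β hβ)).active_le (j, τ))
      (sub_pos.2 hβ.2).le
    dsimp only at h3
    linarith
  by_cases hb : BddBelow (Set.range (R0 j))
  · refine ⟨max ((⨅ σ, R0 j σ) + W) μ, tendsto_minValue_of_forall_lt hR0 hR1 hpos hV hμ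
      (le_max_right _ _) j τ (fun c hc => ?_) fun a ha => ?_⟩
    · have : ⨅ σ, R0 j σ < c - W := by linarith [(max_lt_iff.1 hc).1]
      obtain ⟨N, hN⟩ := exists_lt_of_ciInf_lt this
      exact ⟨N, by linarith⟩
    rcases lt_max_iff.1 ha with ha | ha
    -- Permanent passivity earns at least `w` per slot, hence `V ≥ w / (1 - β)`.
    · filter_upwards [Ico_mem_nhdsLT (zero_lt_one' ℝ)] with β hβ
      refine ha.trans_le ?_
      have hβ1 : 0 < 1 - β := sub_pos.2 hβ.2
      set w := (⨅ σ, R0 j σ) + W with hw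
      set u := w / (1 - β) with hu
      have hwu : w = u - β * u := by rw [hu]; field_simp
      have hs := isMinValue_iff.1 (hV β hβ)
      obtain ⟨A, hA⟩ := hs.bddBelow
      have := le_of_le_max_mul_succ (d := fun σ => u - V β (j, σ)) hβ le_rfl
        ⟨u - A, fun σ => sub_le_sub_left (hA _) _⟩ (fun σ => ?_) τ
      · rw [mul_comm, ← div_le_iff₀ hβ1]
        linarith
      · have h1 := hs.passive_le (j, σ)
        have h2 : ⨅ σ, R0 j σ ≤ R0 j σ := ciInf_le hb σ
        refine le_trans ?_ (le_max_left _ _)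
        dsimp only at h1
        linarith
    · exact hact a ha
  · refine ⟨μ, tendsto_minValue_of_forall_lt hR0 hR1 hpos hV hμ le_rfl j τ (fun c _ => ?_) hact⟩
    rw [not_bddBelow_iff] at hb
    obtain ⟨_, ⟨N, rfl⟩, hN⟩ := hb (c - W)
    exact ⟨N, by linarith⟩

end MinValue

/-! ### Observation probabilities and the stationary distribution. -/

section Observations

variable {K : ℕ} {P : Matrix (Fin K) (Fin K) ℝ} {ps : Fin K → ℝ}

theorem exactObs_nonneg (hP : P ∈ rowStochastic ℝ (Fin K)) (s : BeliefState K) (i : Fin K) :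
    0 ≤ exactObs P s i :=
  nonneg_of_mem_rowStochastic (pow_mem hP _)

theorem sum_exactObs (hP : P ∈ rowStochastic ℝ (Fin K)) (s : BeliefState K) :
    ∑ i, exactObs P s i = 1 :=
  sum_row_of_mem_rowStochastic (pow_mem hP _) _

theorem exists_pow_exactObs_pos (hirr : P.IsIrreducible) (i k : Fin K) :
    ∃ n : ℕ, 0 < ((Matrix.of fun i k => exactObs P (i, 1) k) ^ n) i k := by
  obtain ⟨n, -, hn⟩ := (isIrreducible_iff_exists_pow_pos hirr.nonneg).1 hirr i k
  have : (Matrix.of fun i k => exactObs P (i, 1) k) = P := by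
    ext i k
    simp [exactObs]
  exact ⟨n, by rwa [this]⟩

/-- The stationary distribution of an irreducible chain is positive. -/
theorem stationary_pos (hirr : P.IsIrreducible) (hps : ps ∈ stdSimplex ℝ (Fin K))
    (hst : ps ᵥ* P = ps) (k : Fin K) : 0 < ps k := by
  obtain ⟨i, hi⟩ : ∃ i, 0 < ps i := by
    by_contra! h
    have := Finset.sum_nonpos fun i (_ : i ∈ Finset.univ) => h i
    linarith [hps.2]
  obtain ⟨n, -, hn⟩ := (isIrreducible_iff_exists_pow_pos hirr.nonneg).1 hirr i k
  have hpow : ∀ n : ℕ, ps ᵥ* P ^ n = ps := fun n => by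
    induction n with
    | zero => simp
    | succ n ih => rw [pow_succ, ← vecMul_vecMul, ih, hst]
  have hnn : ∀ n : ℕ, ∀ i j, 0 ≤ (P ^ n) i j := fun n => by
    induction n with
    | zero => intro i j; rw [pow_zero, one_apply]; split_ifs <;> norm_num
    | succ n ih =>
      intro i j
      rw [pow_succ, mul_apply]
      exact Finset.sum_nonneg fun l _ => mul_nonneg (ih i l) (hirr.nonneg l j)
  rw [← hpow n]
  exact (mul_pos hi hn).trans_le (Finset.single_le_sum (f := fun i => ps i * (P ^ n) i k)
    (fun i _ => mul_nonneg (hps.1 i) (hnn n i k)) (Finset.mem_univ i))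

end Observations

/-- The relative error bound from a lower bound `a` and an upper bound `b` of `g`. -/
theorem abs_one_sub_div_le {g x a b : ℝ} (hx : 0 ≤ x) (ha : 0 < a) (hag : a ≤ g) (hgb : g ≤ b) :
    |1 - x / g| ≤ max (1 - x / b) (x / a - 1) := by
  have hg : 0 < g := ha.trans_le hag
  refine abs_le'.2 ⟨le_max_of_le_left ?_, le_max_of_le_right ?_⟩
  · have : x / b ≤ x / g := div_le_div_of_nonneg_left hx hg hgb
    linarith
  · have : x / g ≤ x / a := div_le_div_of_nonneg_left hx ha hag
    linarith

end PilotAllocation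

end

theorem proposition2 {K : ℕ} [NeZero K]
    (P : Matrix (Fin K) (Fin K) ℝ) (hP : P ∈ Matrix.rowStochastic ℝ (Fin K))
    (R0 : Fin K → ℕ+ → ℝ) (R1 W : ℝ)
    (hR0 : ∀ j, Antitone (R0 j)) (hR1 : ∀ j τ, R0 j τ ≤ R1) :
    -- the value functions and the sandwich, for every discount factor
    (∀ β ∈ Set.Ico (0 : ℝ) 1,
      (∃! V, PilotAllocation.IsMaxValue R0 R1 W β V) ∧
      (∃! V, PilotAllocation.IsMinValue R0 R1 W β V) ∧
      ∀ Vmax Vmin : PilotAllocation.BeliefState K → ℝ,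
        PilotAllocation.IsMaxValue R0 R1 W β Vmax →
        PilotAllocation.IsMinValue R0 R1 W β Vmin →
        ∀ s,
          PilotAllocation.discountedValue (PilotAllocation.exactObs P) R0 R1 W β s
            ≤ (Vmax s : EReal) ∧
          (Vmin s : EReal)
            ≤ PilotAllocation.discountedValue (PilotAllocation.exactObs P) R0 R1 W β s) ∧
    -- the error bound for the average reward
    (P.IsIrreducible → 0 < R1 →
      ∀ ps ∈ stdSimplex ℝ (Fin K), ps ᵥ* P = ps →
      ∀ Vmax Vmin : ℝ → PilotAllocation.BeliefState K → ℝ,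
        (∀ β ∈ Set.Ico (0 : ℝ) 1, PilotAllocation.IsMaxValue R0 R1 W β (Vmax β)) →
        (∀ β ∈ Set.Ico (0 : ℝ) 1, PilotAllocation.IsMinValue R0 R1 W β (Vmin β)) →
        ∃ (g gapp gmax : ℝ) (gmin : PilotAllocation.BeliefState K → ℝ),
          (∀ s, PilotAllocation.optimalAverage (PilotAllocation.exactObs P) R0 R1 W s
            = (g : EReal)) ∧
          (∀ s, PilotAllocation.optimalAverage (PilotAllocation.approxObs ps) R0 R1 W s
            = (gapp : EReal)) ∧
          (∀ s, Tendsto (fun β => (1 - β) * Vmax β s) (𝓝[<] 1) (𝓝 gmax)) ∧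
          (∀ s, Tendsto (fun β => (1 - β) * Vmin β s) (𝓝[<] 1) (𝓝 (gmin s))) ∧
          (∀ s, 0 < gmin s ∧ gmin s ≤ g ∧ g ≤ gmax) ∧
          ∀ s, |1 - gapp / g| ≤ max (1 - gapp / gmax) (gapp / gmin s - 1)) := by
  have h0 := PilotAllocation.exactObs_nonneg hP
  have h1 := PilotAllocation.sum_exactObs hP
  have hΦ := PilotAllocation.isTopical_sum h0 h1
  have hsup : ∀ (s : PilotAllocation.BeliefState K) (v : Fin K → ℝ),
      ∑ i, PilotAllocation.exactObs P s i * v i ≤ ⨆ i, v i := fun s v =>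
    hΦ.le_const s fun i => le_ciSup (Set.finite_range v).bddAbove i
  have hinf : ∀ (s : PilotAllocation.BeliefState K) (v : Fin K → ℝ),
      ⨅ i, v i ≤ ∑ i, PilotAllocation.exactObs P s i * v i := fun s v =>
    hΦ.const_le s fun i => ciInf_le (Set.finite_range v).bddBelow i
  refine ⟨fun β hβ => ⟨?_, ?_, fun Vmax Vmin hmax hmin s => ⟨?_, ?_⟩⟩, ?_⟩
  · simpa only [PilotAllocation.isMaxValue_iff] using
      PilotAllocation.existsUnique_isBellmanSolution PilotAllocation.isTopical_iSup hβ hR1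
  · simpa only [PilotAllocation.isMinValue_iff] using
      PilotAllocation.existsUnique_isBellmanSolution PilotAllocation.isTopical_iInf hβ hR1
  · rw [PilotAllocation.isMaxValue_iff] at hmax
    exact PilotAllocation.discountedValue_le h0 h1 hβ hmax.bddBelow (fun a s =>
      (PilotAllocation.reward_add_nextExp_le_bellman Vmax a s).trans
        ((PilotAllocation.bellman_mono_continuation hβ.1 s (hsup _ _)).trans (hmax.2 s).ge)) s
  · rw [PilotAllocation.isMinValue_iff] at hmin
    refine PilotAllocation.le_discountedValue h0 h1 hβ hmin.bddAbove (fun s => ?_) s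
    obtain ⟨a, ha⟩ := PilotAllocation.exists_reward_add_nextExp_eq_bellman
      (ρ := PilotAllocation.exactObs P) (R0 := R0) (R1 := R1) (W := W) (β := β) Vmin s
    exact ⟨a, ((hmin.2 s).le.trans
      (PilotAllocation.bellman_mono_continuation hβ.1 s (hinf _ _))).trans ha.le⟩
  intro hirr hpos ps hps hst Vmax Vmin hmax hmin
  have hps0 := PilotAllocation.stationary_pos hirr hps hst
  obtain ⟨g, V, hg, hV, hgV⟩ := PilotAllocation.exists_optimalAverage_eq (W := W) h0 h1
    (PilotAllocation.exists_pow_exactObs_pos hirr) hR0 hR1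
  have happ0 : ∀ s i, 0 ≤ PilotAllocation.approxObs (K := K) ps s i := fun _ i => hps.1 i
  have happ1 : ∀ s, ∑ i, PilotAllocation.approxObs (K := K) ps s i = 1 := fun _ => hps.2
  -- Positivity of `ps` lets the approximate chain reach every state in one step.
  obtain ⟨gapp, V', hgapp, hV', hgV'⟩ := PilotAllocation.exists_optimalAverage_eq (W := W)
    happ0 happ1 (fun i k => ⟨1, by simpa [PilotAllocation.approxObs] using hps0 k⟩) hR0 hR1
  obtain ⟨gmax, hgmax⟩ := PilotAllocation.exists_tendsto_maxValue hR0 hR1 hmax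
  choose gmin hgmin using PilotAllocation.exists_tendsto_minValue hR0 hR1 hpos hmin
  have hIco : Set.Ico (0 : ℝ) 1 ∈ 𝓝[<] (1 : ℝ) := Ico_mem_nhdsLT (zero_lt_one' ℝ)
  have hmin0 : ∀ s, 0 < gmin s := fun s => hpos.trans_le <| ge_of_tendsto (hgmin s) <| by
    filter_upwards [hIco] with β hβ
    exact (PilotAllocation.isMinValue_iff.1 (hmin β hβ)).le_mul
      PilotAllocation.isTopical_iInf hβ s
  have hming : ∀ s, gmin s ≤ g := fun s => le_of_tendsto_of_tendsto (hgmin s) (hgV s) <| by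
    filter_upwards [hIco] with β hβ
    exact mul_le_mul_of_nonneg_left ((PilotAllocation.isMinValue_iff.1
      (hmin β hβ)).le_of_continuation_le hΦ hβ (hV β hβ) hinf s) (sub_pos.2 hβ.2).le
  have hgmax' : g ≤ gmax := le_of_tendsto_of_tendsto (hgV (0, 1)) (hgmax (0, 1)) <| by
    filter_upwards [hIco] with β hβ
    exact mul_le_mul_of_nonneg_left ((hV β hβ).le_of_continuation_le
      PilotAllocation.isTopical_iSup hβ (PilotAllocation.isMaxValue_iff.1 (hmax β hβ)) hsup _)
      (sub_pos.2 hβ.2).le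
  have happ : 0 ≤ gapp := ge_of_tendsto (hgV' (0, 1)) <| by
    filter_upwards [hIco] with β hβ
    exact hpos.le.trans ((hV' β hβ).le_mul (PilotAllocation.isTopical_sum happ0 happ1) hβ _)
  exact ⟨g, gapp, gmax, gmin, hg, hgapp, hgmax, hgmin,
    fun s => ⟨hmin0 s, hming s, hgmax'⟩,
    fun s => PilotAllocation.abs_one_sub_div_le happ (hmin0 s) (hming s) hgmax'⟩
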